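/- For $t\in\mathbb{R}$ let $\|t\|$ denote the distance from $t$ to the nearest integer. Let $i,j\ge 0$ be real numbers with $i+j=1$. If $i=0$ (resp. $j=0$) we use the convention that $\|t\|^{1/i}=0$ (resp. $\|t\|^{1/j}=0$) for all $t$. Let $$\mathbf{Bad}=\Big\{t\in[0,1]\setminus\mathbb{Q}:\ \exists\, c>0 \text{ such that } \|qt\|>\frac{c}{q}\ \text{ for all } q\in\mathbb{N}\Big\}\qquad(\mathbb{N}=\{1,2,3,\dots\}).$$ If $i,j>0$, let $\mathbf{Bad}(i,j)$ be the set of vectors $\mathbf{x}=(x_1,x_2)\in[0,1]^2$ such that $1,x_1,x_2$ are linearly independent over $\mathbb{Q}$ and for which there exists a constant $c>0$ with $$\max\left\{\|qx_1\|^{1/i},\ \|qx_2\|^{1/j}\right\}>\frac{c}{q}\qquad\text{for all } q\in\mathbb{N}.$$ In the boundary cases let $\mathbf{Bad}(0,1)=[0,1]\times\mathbf{Bad}$ and $\mathbf{Bad}(1,0)=\mathbf{Bad}\times[0,1]$. For $\mathbf{x}\in\mathbf{Bad}(i,j)$, let $\mathbf{Bad}^{\mathbf{x}}(i,j)$ be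 the set of vectors $\boldsymbol\gamma=(\gamma_1,\gamma_2)\in[0,1]^2$ for which there exists a constant $c>0$ such that $$\max\left\{\|qx_1-\gamma_1\|^{1/i},\ \|qx_2-\gamma_2\|^{1/j}\right\}>\frac{c}{|q|}\qquad\text{for all } q\in\mathbb{Z}\setminus\{0\}.$$ **Theorem.** For all real $i,j\ge 0$ with $i+j=1$ and every $\mathbf{x}\in\mathbf{Bad}(i,j)$, the set $\mathbf{Bad}^{\mathbf{x}}(i,j)$ has Hausdorff dimension $2$. -/

import Mathlib

/-- Distance from a real number to the nearest integer. -/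
noncomputable def distInt (t : ℝ) : ℝ := |t - (round t : ℝ)|

/-- `weightPow i t` is `t ^ (1 / i)`, with the convention that it is `0` when the weight `i` is `0`. -/
noncomputable def weightPow (i t : ℝ) : ℝ := if i = 0 then 0 else t ^ (1 / i)

/-- The weighted height `max {‖y₁‖ ^ (1 / i), ‖y₂‖ ^ (1 / j)}` of a vector `y`, where `‖·‖` is the
distance to the nearest integer. -/
noncomputable def weightedDist (i j : ℝ) (y : ℝ × ℝ) : ℝ :=
  max (weightPow i (distInt y.1)) (weightPow j (distInt y.2))

/-- The closed unit square. -/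
def unitSquare : Set (ℝ × ℝ) := Set.Icc (0 : ℝ) 1 ×ˢ Set.Icc (0 : ℝ) 1

/-- A vector `(x₁, x₂)` is irrational if `1, x₁, x₂` are linearly independent over `ℚ`. -/
def IrrationalVector (x : ℝ × ℝ) : Prop := LinearIndependent ℚ ![(1 : ℝ), x.1, x.2]

/-- The one-dimensional set of badly approximable numbers in the unit interval. -/
def badOne : Set ℝ :=
  {t | t ∈ Set.Icc (0 : ℝ) 1 ∧ Irrational t ∧
    ∃ c : ℝ, 0 < c ∧ ∀ q : ℕ, 0 < q → c / (q : ℝ) < distInt ((q : ℝ) * t)}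

open Classical in
/-- The `(i, j)`-badly approximable vectors of the unit square. In the boundary cases the set is
`[0, 1] × Bad` (for `i = 0`) and `Bad × [0, 1]` (for `j = 0`). -/
noncomputable def badSet (i j : ℝ) : Set (ℝ × ℝ) :=
  if i = 0 then Set.Icc (0 : ℝ) 1 ×ˢ badOne
  else if j = 0 then badOne ×ˢ Set.Icc (0 : ℝ) 1
  else {x | x ∈ unitSquare ∧ IrrationalVector x ∧
    ∃ c : ℝ, 0 < c ∧ ∀ q : ℕ, 0 < q → c / (q : ℝ) < weightedDist i j ((q : ℝ) • x)}

/-- The twisted inhomogeneous badly approximable set attached to `x`: the vectors `γ` of the unit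
square that are badly approximable by the multiples `q x`, with `q` a non-zero integer. -/
def twistedBadSet (x : ℝ × ℝ) (i j : ℝ) : Set (ℝ × ℝ) :=
  {γ | γ ∈ unitSquare ∧
    ∃ c : ℝ, 0 < c ∧ ∀ q : ℤ, q ≠ 0 → c / |(q : ℝ)| < weightedDist i j ((q : ℝ) • x - γ)}

/-! By symmetry let `i ≤ j`. Fix `K`, put `M = 2K + 2` and `T = M ^ (1/j)`, and build nested squares
of side `ρ / M ^ m`. If two distinct multiples of `x` with factors in the range `[T ^ m, T ^ (m +
1))` came near one square of generation `m`, their difference would be too close to an integer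
vector for a badly approximable `x` (`eq_of_distInt_sub_le`). So one multiple at most matters for
each square, and its neighbourhood is less tall than a cell of the `M × M` subdivision: it meets at
most one of the `K + 1` even rows (`exists_bad_row`). Discarding such a row leaves `K` rows and `K`
even columns, whose cells are a cell width apart. The resulting Cantor set avoids every
neighbourhood, and `le_dimH_of_digit_separation` gives dimension at least `2 log K / log (2K + 2)`,
which tends to `2` as `K → ∞`. -/

/-! ### Dimension bounds from digit codings -/

/-- If the points of `A` are coded by pairs of digit sequences in base `K`, in such a way that pairs
which first differ in position `n` give points at distance at least `κ / M ^ n`, then the dimension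
of `A` is at least `2 log K / log M`. -/
theorem le_dimH_of_digit_separation {X : Type*} [MetricSpace X] {A : Set X} {K : ℕ} (hK : 1 < K)
    {M κ : ℝ} (hM : 1 < M) (hκ : 0 < κ) (g : (ℕ → Fin K) × (ℕ → Fin K) → X) (hgA : ∀ σ, g σ ∈ A)
    (hsep : ∀ σ τ n, (∀ k < n, σ.1 k = τ.1 k ∧ σ.2 k = τ.2 k) →
      (σ.1 n ≠ τ.1 n ∨ σ.2 n ≠ τ.2 n) → κ / M ^ n ≤ dist (g σ) (g τ)) :
    ENNReal.ofReal (2 * (Real.log K / Real.log M)) ≤ dimH A := by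
  have hK' : (1 : ℝ) < K := by exact_mod_cast hK
  have hM0 : 0 < M := by linarith
  have hlM : 0 < Real.log M := Real.log_pos hM
  set r : ℝ := Real.log K / Real.log M with hr
  have hr0 : 0 < r := div_pos (Real.log_pos hK') hlM
  have hMr : M ^ r = K := by
    rw [Real.rpow_def_of_pos hM0, hr, mul_div_cancel₀ _ hlM.ne', Real.exp_log (by linarith)]
  have hfirst : ∀ σ τ : (ℕ → Fin K) × (ℕ → Fin K), σ ≠ τ → ∃ n,
      (∀ k < n, σ.1 k = τ.1 k ∧ σ.2 k = τ.2 k) ∧ (σ.1 n ≠ τ.1 n ∨ σ.2 n ≠ τ.2 n) := by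
    classical
    intro σ τ hne
    have hex : ∃ n, σ.1 n ≠ τ.1 n ∨ σ.2 n ≠ τ.2 n := by
      by_contra! hcon
      exact hne (Prod.ext (funext fun n => (hcon n).1) (funext fun n => (hcon n).2))
    refine ⟨Nat.find hex, fun k hk => ?_, Nat.find_spec hex⟩
    simpa using Nat.find_min hex hk
  have hinj : Function.Injective g := by
    intro σ τ hστ
    by_contra hne
    obtain ⟨n, h1, h2⟩ := hfirst σ τ hne
    have h3 := hsep σ τ n h1 h2
    rw [hστ, dist_self] at h3
    exact absurd h3 (not_le.2 (by positivity))
  -- Since `M ^ r = K`, the decoding `g σ ↦ h σ` is Hölder of exponent `r`. Its image is the whole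
  -- unit square, of dimension `2`, so its domain has dimension at least `2 * r`.
  let h : (ℕ → Fin K) × (ℕ → Fin K) → ℝ × ℝ := fun σ => (Real.ofDigits σ.1, Real.ofDigits σ.2)
  have hhol : ∀ σ τ, dist (h σ) (h τ) ≤ (1 / κ) ^ r * dist (g σ) (g τ) ^ r := by
    intro σ τ
    rcases eq_or_ne σ τ with rfl | hne
    · simp only [dist_self]; positivity
    obtain ⟨n, h1, h2⟩ := hfirst σ τ hne
    have h3 := hsep σ τ n h1 h2
    have h4 : dist (h σ) (h τ) ≤ ((K : ℝ) ^ n)⁻¹ := by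
      rw [Prod.dist_eq]
      exact max_le (Real.abs_ofDigits_sub_ofDigits_le fun k hk => (h1 k hk).1)
        (Real.abs_ofDigits_sub_ofDigits_le fun k hk => (h1 k hk).2)
    refine h4.trans ?_
    rw [← Real.mul_rpow (by positivity) dist_nonneg, ← hMr, ← Real.rpow_natCast, ← Real.rpow_mul
      hM0.le, mul_comm r, Real.rpow_mul hM0.le, ← Real.inv_rpow (by positivity), Real.rpow_natCast]
    refine Real.rpow_le_rpow (by positivity) ?_ hr0.le
    calc (M ^ n)⁻¹ = 1 / κ * (κ / M ^ n) := by field_simp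
      _ ≤ _ := by gcongr
  have : Nonempty ((ℕ → Fin K) × (ℕ → Fin K)) :=
    ⟨fun _ => ⟨0, by omega⟩, fun _ => ⟨0, by omega⟩⟩
  let f : X → ℝ × ℝ := fun y => h (Function.invFun g y)
  have hfg : ∀ σ, f (g σ) = h σ := fun σ => congrArg h (Function.leftInverse_invFun hinj σ)
  have hf : HolderOnWith ((1 / κ) ^ r).toNNReal r.toNNReal f (Set.range g) := by
    rintro _ ⟨σ, rfl⟩ _ ⟨τ, rfl⟩
    rw [hfg, hfg, edist_dist, edist_dist, Real.coe_toNNReal _ hr0.le,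
      ENNReal.ofReal_rpow_of_nonneg dist_nonneg hr0.le, ← ENNReal.ofReal,
      ← ENNReal.ofReal_mul (by positivity)]
    exact ENNReal.ofReal_le_ofReal (hhol σ τ)
  have himg : Set.Icc (0 : ℝ × ℝ) 1 ⊆ f '' Set.range g := by
    rintro ⟨y₁, y₂⟩ hy
    obtain ⟨⟨h1, h2⟩, ⟨h3, h4⟩⟩ := hy
    obtain ⟨a, -, ha⟩ := Real.ofDigits_SurjOn hK ⟨h1, h3⟩
    obtain ⟨b, -, hb⟩ := Real.ofDigits_SurjOn hK ⟨h2, h4⟩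
    exact ⟨g (a, b), ⟨_, rfl⟩, by rw [hfg]; exact Prod.ext ha hb⟩
  have hsq : dimH (Set.Icc (0 : ℝ × ℝ) 1) = 2 := by
    rw [Real.dimH_of_nonempty_interior]
    · simp
    · refine ⟨(1 / 2, 1 / 2), ?_⟩
      rw [← Prod.mk_zero_zero, ← Prod.mk_one_one, ← Set.Icc_prod_Icc, interior_prod_eq]
      norm_num [interior_Icc]
  have hle := hf.dimH_image_le (Real.toNNReal_pos.2 hr0)
  have hrp : (r.toNNReal : ENNReal) ≠ 0 := by simpa using hr0
  calc ENNReal.ofReal (2 * r) = 2 * r.toNNReal := by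
        rw [ENNReal.ofReal_mul (by norm_num), ENNReal.ofReal_ofNat]; rfl
    _ ≤ dimH (Set.range g) := by
        rw [← ENNReal.le_div_iff_mul_le (Or.inl hrp) (Or.inl ENNReal.coe_ne_top), ← hsq]
        exact (dimH_mono himg).trans hle
    _ ≤ dimH A := dimH_mono (Set.range_subset_iff.2 hgA)

open Filter Topology in
theorem tendsto_log_div_log_two_mul_add :
    Tendsto (fun K : ℕ => 2 * (Real.log K / Real.log (2 * K + 2))) atTop (𝓝 2) := by
  have h : Tendsto (fun K : ℕ => Real.log ((2 * K + 2) / K) / Real.log K) atTop (𝓝 0) := by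
    have h1 : Tendsto (fun K : ℕ => Real.log ((2 * K + 2) / K)) atTop (𝓝 (Real.log 2)) := by
      refine Tendsto.log ?_ (by norm_num)
      have h2 : Tendsto (fun K : ℕ => (2 : ℝ) + 2 / K) atTop (𝓝 (2 + 0)) :=
        tendsto_const_nhds.add (tendsto_const_div_atTop_nhds_zero_nat 2)
      rw [add_zero] at h2
      refine h2.congr' ?_
      filter_upwards [eventually_gt_atTop 0] with K hK
      have : (K : ℝ) ≠ 0 := by positivity
      field_simp
    exact h1.div_atTop (Real.tendsto_log_atTop.comp tendsto_natCast_atTop_atTop)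
  have h3 : Tendsto (fun K : ℕ => 2 * (1 / (1 + Real.log ((2 * K + 2) / K) / Real.log K))) atTop
      (𝓝 (2 * (1 / (1 + 0)))) :=
    (tendsto_const_nhds.div (tendsto_const_nhds.add h) (by norm_num)).const_mul 2
  norm_num at h3
  refine h3.congr' ?_
  filter_upwards [eventually_gt_atTop 1] with K hK
  have hK1 : (1 : ℝ) < K := by exact_mod_cast hK
  have hl : 0 < Real.log K := Real.log_pos hK1
  have hl2 : 0 < Real.log (2 * K + 2) := Real.log_pos (by linarith)
  rw [Real.log_div (by positivity) (by positivity)]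
  field_simp
  ring

/-! ### Distance to the nearest integer and weighted powers -/

theorem distInt_le_abs_sub (t : ℝ) (z : ℤ) : distInt t ≤ |t - z| := round_le t z

theorem distInt_nonneg (t : ℝ) : 0 ≤ distInt t := abs_nonneg _

theorem distInt_le_half (t : ℝ) : distInt t ≤ 1 / 2 := abs_sub_round t

theorem distInt_neg (t : ℝ) : distInt (-t) = distInt t := by
  have h : ∀ s, distInt (-s) ≤ distInt s := fun s =>
    (distInt_le_abs_sub (-s) (-round s)).trans_eq (by
      rw [distInt, ← abs_neg]; push_cast; congr 1; ring)
  exact (h t).antisymm (by simpa using h (-t))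

theorem distInt_sub_le (s t : ℝ) : distInt (s - t) ≤ distInt s + distInt t :=
  (distInt_le_abs_sub (s - t) (round s - round t)).trans (by
    unfold distInt
    refine le_trans (le_of_eq ?_) (abs_sub (s - round s) (t - round t))
    push_cast; congr 1; ring)

theorem distInt_le_abs (t : ℝ) : distInt t ≤ |t| := by simpa using distInt_le_abs_sub t 0

theorem distInt_eq_abs {t : ℝ} (ht : |t| < 1 / 2) : distInt t = |t| := by
  obtain ⟨h1, h2⟩ := abs_lt.1 ht
  have : round t = 0 := by
    rw [round_eq, Int.floor_eq_zero_iff]; constructor <;> linarith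
  simp [distInt, this]

theorem weightPow_le {i s t : ℝ} (hi : 0 ≤ i) (hs : 0 ≤ s) (ht : 0 ≤ t) (h : t ≤ s ^ i) :
    weightPow i t ≤ s := by
  unfold weightPow
  split_ifs with h0
  · exact hs
  · calc t ^ (1 / i) ≤ (s ^ i) ^ (1 / i) := Real.rpow_le_rpow ht h (by positivity)
      _ = s := by rw [← Real.rpow_mul hs, mul_one_div_cancel h0, Real.rpow_one]

/-- For `i = 0` the hypothesis `h` reads `1 < t`, against `ht`; the zero convention thus needs no
separate treatment later. -/
theorem lt_weightPow {i s t : ℝ} (hi : 0 ≤ i) (hs : 0 ≤ s) (ht : t < 1) (h : s ^ i < t) :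
    s < weightPow i t := by
  unfold weightPow
  split_ifs with h0
  · rw [h0, Real.rpow_zero] at h
    exact absurd h (not_lt.2 ht.le)
  · calc s = (s ^ i) ^ (1 / i) := by rw [← Real.rpow_mul hs, mul_one_div_cancel h0, Real.rpow_one]
      _ < _ := Real.rpow_lt_rpow (by positivity) h (by positivity)

/-- A sequence that moves at step `m` by an even number of cells of a grid of mesh
`ρ / (2 * K + 2) ^ (m + 1)`. -/
theorem iSup_mem_Icc_of_even_steps {K : ℕ} {ρ : ℝ} (hρ : 0 ≤ ρ) {v : ℕ → ℝ}
    (hv : ∀ m, ∃ d : ℕ, d ≤ K ∧ v (m + 1) = v m + ρ / (2 * K + 2) ^ (m + 1) * (2 * d)) (n : ℕ) :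
    ⨆ m, v m ∈ Set.Icc (v n) (v n + ρ / (2 * K + 2) ^ n) := by
  have h := Monotone.ciSup_mem_iInter_Icc_of_antitone (f := v)
    (g := fun n => v n + ρ / (2 * K + 2) ^ n) ?_ ?_ ?_
  · exact Set.mem_iInter.1 h n
  · refine monotone_nat_of_le_succ fun m => ?_
    obtain ⟨d, -, hd⟩ := hv m
    rw [hd]
    exact le_add_of_nonneg_right (by positivity)
  · refine antitone_nat_of_succ_le fun m => ?_
    obtain ⟨d, hdK, hd⟩ := hv m
    have hd' : (d : ℝ) ≤ K := by exact_mod_cast hdK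
    have h1 : ρ / (2 * K + 2) ^ m = ρ / (2 * K + 2) ^ (m + 1) * (2 * K + 2) := by
      rw [pow_succ]; field_simp
    have h2 : 0 ≤ ρ / (2 * (K : ℝ) + 2) ^ (m + 1) := by positivity
    simp only [hd]
    rw [h1]
    nlinarith
  · exact fun m => le_add_of_nonneg_right (by positivity)

/-! ### Separation of multiples and the row to avoid -/

/-- Distinct multiples of a badly approximable vector are not close modulo one. -/
theorem eq_of_distInt_sub_le {i j c : ℝ} (hi : 0 ≤ i) (hj : 0 ≤ j) (hc : 0 < c) {x : ℝ × ℝ}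
    (hx : ∀ q : ℕ, 0 < q → c / (q : ℝ) < weightedDist i j ((q : ℝ) • x)) {Q : ℝ} {q r : ℤ}
    (hq : |(q : ℝ)| ≤ Q) (hr : |(r : ℝ)| ≤ Q)
    (h1 : distInt (q * x.1 - r * x.1) ≤ (c / (2 * Q)) ^ i)
    (h2 : distInt (q * x.2 - r * x.2) ≤ (c / (2 * Q)) ^ j) : q = r := by
  by_contra hne
  have hd : 0 < (q - r).natAbs := Int.natAbs_pos.2 (sub_ne_zero.2 hne)
  have hd' : (0 : ℝ) < (q - r).natAbs := by exact_mod_cast hd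
  have hcast : ((q - r).natAbs : ℝ) = |(q : ℝ) - r| := by
    rw [Nat.cast_natAbs]; push_cast; rfl
  -- Hence `c / (2 * Q) ≤ c / |q - r|`, and the two closeness hypotheses contradict `hx` at `|q -
  -- r|`.
  have hle : ((q - r).natAbs : ℝ) ≤ 2 * Q := by
    rw [hcast]
    exact (abs_sub _ _).trans (by linarith)
  have hmul : ∀ t : ℝ, distInt (((q - r).natAbs : ℝ) * t) = distInt (q * t - r * t) := by
    intro t
    rw [hcast, ← sub_mul]
    rcases abs_choice ((q : ℝ) - r) with h | h <;> rw [h]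
    rw [neg_mul, distInt_neg]
  have hQ : 0 ≤ c / (2 * Q) := by
    have : 0 ≤ Q := (abs_nonneg _).trans hq
    positivity
  have h := hx _ hd
  refine absurd h (not_lt.2 (max_le ?_ ?_))
  · refine (weightPow_le hi hQ (distInt_nonneg _) ?_).trans (by gcongr)
    rwa [Prod.smul_fst, smul_eq_mul, hmul]
  · refine (weightPow_le hj hQ (distInt_nonneg _) ?_).trans (by gcongr)
    rwa [Prod.smul_snd, smul_eq_mul, hmul]

/-- The two coordinates of `γ` are `(δ / |q|) ^ i` and `(δ / |q|) ^ j` close to those of `q • x`,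
modulo one. -/
def NearMultiple (i j δ : ℝ) (x γ : ℝ × ℝ) (q : ℤ) : Prop :=
  distInt (q * x.1 - γ.1) ≤ (δ / |(q : ℝ)|) ^ i ∧ distInt (q * x.2 - γ.2) ≤ (δ / |(q : ℝ)|) ^ j

theorem mem_twistedBadSet {i j δ : ℝ} (hi : 0 ≤ i) (hj : 0 ≤ j) (hδ : 0 < δ) {x γ : ℝ × ℝ}
    (hγ : γ ∈ unitSquare) (h : ∀ q : ℤ, q ≠ 0 → ¬ NearMultiple i j δ x γ q) :
    γ ∈ twistedBadSet x i j := by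
  refine ⟨hγ, δ, hδ, fun q hq => ?_⟩
  have hlt : ∀ t, distInt t < 1 := fun t => (distInt_le_half t).trans_lt (by norm_num)
  by_contra hcon
  refine h q hq ⟨?_, ?_⟩
  · by_contra! h1
    exact hcon (lt_max_of_lt_left (lt_weightPow hi (by positivity) (hlt _) (by simpa using h1)))
  · by_contra! h1
    exact hcon (lt_max_of_lt_right (lt_weightPow hj (by positivity) (hlt _) (by simpa using h1)))

/-- There are a size `ρ` of squares and a radius `δ` of neighbourhoods so small that a square meets
at most one neighbourhood of a multiple in each range `[T ^ m, T ^ (m + 1))`. -/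
theorem exists_small_constants {i j c T M : ℝ} (hi : 0 ≤ i) (hj : 0 < j) (hc : 0 < c)
    (hT : 0 < T) (hM : 0 < M) :
    ∃ δ ρ : ℝ, 0 < δ ∧ 0 < ρ ∧ ρ ≤ 1 / 4 ∧ 2 * δ ^ j < ρ / M ∧ 2 * δ ^ j + ρ ≤ (c / (2 * T)) ^ j ∧
      (i = 0 ∨ 2 * δ ^ i + ρ ≤ (c / (2 * T)) ^ i) := by
  set A := c / (2 * T)
  have hA : 0 < A := by positivity
  -- `ρ` and `2 * δ ^ k` each take half of `A ^ k`; `δ` is chosen after `ρ`.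
  obtain ⟨ρ, hρ, h1, h2, h3⟩ : ∃ ρ : ℝ, 0 < ρ ∧ ρ ≤ 1 / 4 ∧ ρ ≤ A ^ i / 2 ∧ ρ ≤ A ^ j / 2 :=
    ⟨min (1 / 4) (min (A ^ i / 2) (A ^ j / 2)), by positivity, min_le_left _ _,
      (min_le_right _ _).trans (min_le_left _ _), (min_le_right _ _).trans (min_le_right _ _)⟩
  have hsmall : ∀ k : ℝ, 0 < k → ∀ ε : ℝ, 0 < ε → ∃ δ₀ : ℝ, 0 < δ₀ ∧
      ∀ δ, 0 < δ → δ ≤ δ₀ → δ ^ k ≤ ε := fun k hk ε hε =>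
    ⟨ε ^ (1 / k), by positivity, fun δ hδ h => by
      calc δ ^ k ≤ (ε ^ (1 / k)) ^ k := Real.rpow_le_rpow hδ.le h hk.le
        _ = ε := by rw [← Real.rpow_mul hε.le, one_div_mul_cancel hk.ne', Real.rpow_one]⟩
  obtain ⟨δ₁, hδ₁, hj1⟩ := hsmall j hj (min (ρ / M / 4) (A ^ j / 4)) (by positivity)
  have hρM : 0 < ρ / M := by positivity
  -- `δ ^ 0 = 1` cannot be made small, hence the alternative `i = 0`.
  rcases hi.eq_or_lt with h0 | h0
  · have h4 := le_min_iff.1 (hj1 δ₁ hδ₁ le_rfl)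
    exact ⟨δ₁, ρ, hδ₁, hρ, h1, by linarith [h4.1], by linarith [h4.2], Or.inl h0.symm⟩
  · obtain ⟨δ₂, hδ₂, hi1⟩ := hsmall i h0 (A ^ i / 4) (by positivity)
    have hm : 0 < min δ₁ δ₂ := lt_min hδ₁ hδ₂
    have h4 := le_min_iff.1 (hj1 _ hm (min_le_left _ _))
    have h5 := hi1 _ hm (min_le_right _ _)
    exact ⟨_, ρ, hm, hρ, h1, by linarith [h4.1], by linarith [h4.2], Or.inr (by linarith)⟩

/-- In each square of a given generation only one row of cells meets the neighbourhoods of the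
multiples of `x` in the corresponding range. -/
theorem exists_bad_row {i j c T δ ρ : ℝ} {K : ℕ} (hi : 0 ≤ i) (hij : i ≤ j) (hc : 0 < c)
    (hT : 1 ≤ T) (hTM : T ^ j = 2 * K + 2) (hδ : 0 < δ) (hρ : 0 < ρ) (hρ4 : ρ ≤ 1 / 4)
    (hδρ : 2 * δ ^ j < ρ / (2 * K + 2)) (hA : 2 * δ ^ j + ρ ≤ (c / (2 * T)) ^ j)
    (hA' : i = 0 ∨ 2 * δ ^ i + ρ ≤ (c / (2 * T)) ^ i) {x : ℝ × ℝ}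
    (hx : ∀ q : ℕ, 0 < q → c / (q : ℝ) < weightedDist i j ((q : ℝ) • x)) (m : ℕ) (u : ℝ × ℝ) :
    ∃ p : Fin (K + 1), ∀ (q : ℤ) (γ : ℝ × ℝ) (k : Fin (K + 1)),
      T ^ m ≤ |(q : ℝ)| → |(q : ℝ)| < T ^ (m + 1) →
      γ.1 ∈ Set.Icc u.1 (u.1 + ρ / (2 * K + 2) ^ m) →
      γ.2 ∈ Set.Icc u.2 (u.2 + ρ / (2 * K + 2) ^ m) →
      γ.2 ∈ Set.Icc (u.2 + ρ / (2 * K + 2) ^ (m + 1) * (2 * (k : ℕ)))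
        (u.2 + ρ / (2 * K + 2) ^ (m + 1) * (2 * (k : ℕ) + 1)) →
      NearMultiple i j δ x γ q → k = p := by
  have hj : 0 ≤ j := hi.trans hij
  have hT0 : 0 < T := by linarith
  set M : ℝ := 2 * K + 2 with hM
  have hM2 : 2 ≤ M := by rw [hM]; linarith [(Nat.cast_nonneg K : (0 : ℝ) ≤ K)]
  have hM0 : 0 < M := by linarith
  set s : ℝ := 1 / T ^ m with hs
  have hs0 : 0 < s := by positivity
  have hs1 : s ≤ 1 := by
    rw [hs, div_le_one (by positivity)]; exact one_le_pow₀ hT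
  have hsj : s ^ j = 1 / M ^ m := by
    rw [hs, Real.div_rpow zero_le_one (by positivity), Real.one_rpow, ← Real.rpow_natCast,
      ← Real.rpow_mul hT0.le, mul_comm, Real.rpow_mul hT0.le, hTM, Real.rpow_natCast]
  have hMs : ρ / M ^ m = ρ * s ^ j := by rw [hsj]; ring
  -- Here `i ≤ j` enters: the side `ρ * s ^ j` of the square is at most `ρ * s ^ i`, the scale
  -- allowed in the first coordinate.
  have hsji : s ^ j ≤ s ^ i := Real.rpow_le_rpow_of_exponent_ge hs0 hs1 hij
  have hbound : ∀ k : ℝ, 0 ≤ k → ∀ q : ℤ, T ^ m ≤ |(q : ℝ)| →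
      (δ / |(q : ℝ)|) ^ k ≤ δ ^ k * s ^ k := by
    intro k hk q hq
    rw [← Real.mul_rpow hδ.le hs0.le, hs, mul_one_div]
    refine Real.rpow_le_rpow (by positivity) ?_ hk
    gcongr
  have hAs : ∀ k : ℝ, (c / (2 * T ^ (m + 1))) ^ k = (c / (2 * T)) ^ k * s ^ k := by
    intro k
    rw [← Real.mul_rpow (by positivity) hs0.le, hs]
    congr 1
    rw [pow_succ]; field_simp
  have htri : ∀ a b t t' : ℝ, distInt (a - b) ≤ distInt (a - t) + distInt (b - t') + |t - t'| := by
    intro a b t t'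
    have h1 := distInt_sub_le (a - t) (b - t')
    have h2 := distInt_sub_le ((a - t) - (b - t')) (t' - t)
    rw [show (a - t) - (b - t') - (t' - t) = a - b by ring] at h2
    have h3 := distInt_le_abs (t' - t)
    rw [abs_sub_comm] at h3
    linarith
  have habs : ∀ a L t t' : ℝ, t ∈ Set.Icc a (a + L) → t' ∈ Set.Icc a (a + L) → |t - t'| ≤ L :=
    fun a L t t' h h' => abs_le.2 ⟨by linarith [h.1, h'.2], by linarith [h.2, h'.1]⟩
  -- If no even row is met, any `p` will do; otherwise `p` is the row of one witness, and all others
  -- must agree with it.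
  by_cases hex : ∃ (q : ℤ) (γ : ℝ × ℝ) (k : Fin (K + 1)),
      T ^ m ≤ |(q : ℝ)| ∧ |(q : ℝ)| < T ^ (m + 1) ∧
      γ.1 ∈ Set.Icc u.1 (u.1 + ρ / M ^ m) ∧ γ.2 ∈ Set.Icc u.2 (u.2 + ρ / M ^ m) ∧
      γ.2 ∈ Set.Icc (u.2 + ρ / M ^ (m + 1) * (2 * (k : ℕ)))
        (u.2 + ρ / M ^ (m + 1) * (2 * (k : ℕ) + 1)) ∧ NearMultiple i j δ x γ q
  swap
  · exact ⟨0, fun q γ k h1 h2 h3 h4 h5 h6 => (hex ⟨q, γ, k, h1, h2, h3, h4, h5, h6⟩).elim⟩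
  obtain ⟨q, γ, p, h1, h2, h3, h4, h5, h6⟩ := hex
  refine ⟨p, fun q' γ' k h1' h2' h3' h4' h5' h6' => ?_⟩
  have hb := hbound j hj q h1
  have hb' := hbound j hj q' h1'
  have hsj0 : 0 < s ^ j := by positivity
  have hqq : q = q' := by
    refine eq_of_distInt_sub_le hi hj hc hx h2.le h2'.le ?_ ?_
    · rcases hA' with h0 | hA'
      · rw [h0, Real.rpow_zero]
        exact (distInt_le_half _).trans (by norm_num)
      · have hbi := hbound i hi q h1
        have hbi' := hbound i hi q' h1'
        have ht := htri (q * x.1) (q' * x.1) γ.1 γ'.1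
        have hd := habs _ _ _ _ h3 h3'
        rw [hAs]
        have hρs : ρ * s ^ j ≤ ρ * s ^ i := by gcongr
        have : (2 * δ ^ i + ρ) * s ^ i ≤ (c / (2 * T)) ^ i * s ^ i := by gcongr
        linarith [h6.1, h6'.1]
    · have ht := htri (q * x.2) (q' * x.2) γ.2 γ'.2
      have hd := habs _ _ _ _ h4 h4'
      rw [hAs]
      have : (2 * δ ^ j + ρ) * s ^ j ≤ (c / (2 * T)) ^ j * s ^ j := by gcongr
      linarith [h6.2, h6'.2]
  subst hqq
  have hd := habs _ _ _ _ h4 h4'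
  have hd2 : |γ.2 - γ'.2| < 1 / 2 := by
    have : ρ / M ^ m ≤ ρ := div_le_self hρ.le (one_le_pow₀ (by linarith))
    linarith
  -- Both heights are near the same `q * x.2` modulo one, so they differ by less than a cell, while
  -- distinct even rows have a full odd row between them.
  have hclose : |γ.2 - γ'.2| < ρ / M ^ (m + 1) := by
    have ht := distInt_sub_le (q * x.2 - γ'.2) (q * x.2 - γ.2)
    rw [show (q * x.2 - γ'.2) - (q * x.2 - γ.2) = γ.2 - γ'.2 by ring, distInt_eq_abs hd2] at ht
    have h7 : 2 * δ ^ j * s ^ j < ρ / M * s ^ j := by gcongr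
    have h8 : ρ / M * s ^ j = ρ / M ^ (m + 1) := by rw [hsj, pow_succ]; field_simp
    linarith [h6.2, h6'.2]
  obtain ⟨h9, h10⟩ := abs_lt.1 hclose
  set w := ρ / M ^ (m + 1) with hw
  have hw0 : 0 < w := by positivity
  obtain ⟨h5a, h5b⟩ := h5
  obtain ⟨h5a', h5b'⟩ := h5'
  by_contra hne
  rcases lt_or_gt_of_ne (fun h => hne (Fin.ext h) : (k : ℕ) ≠ p) with hlt | hlt
  · have : ((k : ℕ) : ℝ) + 1 ≤ (p : ℕ) := by exact_mod_cast hlt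
    nlinarith
  · have : ((p : ℕ) : ℝ) + 1 ≤ (k : ℕ) := by exact_mod_cast hlt
    nlinarith

/-! ### The Cantor set of nested squares -/

/-- The lower left corners of the nested squares coded by the digit sequences `σ`. The row `p m u`
is avoided in the square with corner `u` of generation `m`. -/
noncomputable def squareCorner {K : ℕ} (ρ : ℝ) (p : ℕ → ℝ × ℝ → Fin (K + 1))
    (σ : (ℕ → Fin K) × (ℕ → Fin K)) : ℕ → ℝ × ℝ
  | 0 => 0
  | m + 1 =>
    ((squareCorner ρ p σ m).1 + ρ / (2 * K + 2) ^ (m + 1) * (2 * (σ.1 m : ℕ)),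
      (squareCorner ρ p σ m).2 + ρ / (2 * K + 2) ^ (m + 1) *
        (2 * ((p m (squareCorner ρ p σ m)).succAbove (σ.2 m) : ℕ)))

theorem squareCorner_congr {K : ℕ} {ρ : ℝ} {p : ℕ → ℝ × ℝ → Fin (K + 1)}
    {σ τ : (ℕ → Fin K) × (ℕ → Fin K)} {n : ℕ} (h : ∀ k < n, σ.1 k = τ.1 k ∧ σ.2 k = τ.2 k) :
    squareCorner ρ p σ n = squareCorner ρ p τ n := by
  induction n with
  | zero => rfl
  | succ n ih =>
    have ih' := ih fun k hk => h k (by omega)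
    obtain ⟨h1, h2⟩ := h n (by omega)
    simp only [squareCorner, ih', h1, h2]

/-- The common point of the nested squares coded by `σ`. -/
noncomputable def squarePoint {K : ℕ} (ρ : ℝ) (p : ℕ → ℝ × ℝ → Fin (K + 1))
    (σ : (ℕ → Fin K) × (ℕ → Fin K)) : ℝ × ℝ :=
  (⨆ m, (squareCorner ρ p σ m).1, ⨆ m, (squareCorner ρ p σ m).2)

theorem squarePoint_fst_mem {K : ℕ} {ρ : ℝ} (hρ : 0 ≤ ρ) (p : ℕ → ℝ × ℝ → Fin (K + 1))
    (σ : (ℕ → Fin K) × (ℕ → Fin K)) (n : ℕ) :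
    (squarePoint ρ p σ).1 ∈ Set.Icc (squareCorner ρ p σ n).1
      ((squareCorner ρ p σ n).1 + ρ / (2 * K + 2) ^ n) :=
  iSup_mem_Icc_of_even_steps (v := fun m => (squareCorner ρ p σ m).1) hρ
    (fun m => ⟨σ.1 m, (σ.1 m).2.le, rfl⟩) n

theorem squarePoint_snd_mem {K : ℕ} {ρ : ℝ} (hρ : 0 ≤ ρ) (p : ℕ → ℝ × ℝ → Fin (K + 1))
    (σ : (ℕ → Fin K) × (ℕ → Fin K)) (n : ℕ) :
    (squarePoint ρ p σ).2 ∈ Set.Icc (squareCorner ρ p σ n).2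
      ((squareCorner ρ p σ n).2 + ρ / (2 * K + 2) ^ n) :=
  iSup_mem_Icc_of_even_steps (v := fun m => (squareCorner ρ p σ m).2) hρ
    (fun m => ⟨(p m (squareCorner ρ p σ m)).succAbove (σ.2 m), Fin.is_le _, rfl⟩) n

theorem le_abs_sub_of_even_cells {a w s t : ℝ} {k l : ℕ} (hw : 0 ≤ w) (hkl : k ≠ l)
    (hs : s ∈ Set.Icc (a + w * (2 * k)) (a + w * (2 * k) + w))
    (ht : t ∈ Set.Icc (a + w * (2 * l)) (a + w * (2 * l) + w)) : w ≤ |s - t| := by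
  obtain ⟨h1, h2⟩ := hs
  obtain ⟨h3, h4⟩ := ht
  rcases lt_or_gt_of_ne hkl with h | h
  · have : (k : ℝ) + 1 ≤ l := by exact_mod_cast h
    exact le_abs.2 (Or.inr (by nlinarith))
  · have : (l : ℝ) + 1 ≤ k := by exact_mod_cast h
    exact le_abs.2 (Or.inl (by nlinarith))

/-- Equal earlier digits give the same parent square, in which the digits `n` select different even
columns or rows; for rows this uses injectivity of `succAbove`. -/
theorem le_dist_squarePoint {K : ℕ} {ρ : ℝ} (hρ : 0 ≤ ρ) (p : ℕ → ℝ × ℝ → Fin (K + 1))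
    {σ τ : (ℕ → Fin K) × (ℕ → Fin K)} {n : ℕ} (h : ∀ k < n, σ.1 k = τ.1 k ∧ σ.2 k = τ.2 k)
    (hne : σ.1 n ≠ τ.1 n ∨ σ.2 n ≠ τ.2 n) :
    ρ / (2 * K + 2) ^ (n + 1) ≤ dist (squarePoint ρ p σ) (squarePoint ρ p τ) := by
  have hc := squareCorner_congr (ρ := ρ) (p := p) h
  rw [Prod.dist_eq]
  rcases hne with hne | hne
  · refine le_max_of_le_left ?_
    have h1 := squarePoint_fst_mem hρ p σ (n + 1)
    have h2 := squarePoint_fst_mem hρ p τ (n + 1)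
    simp only [squareCorner, hc] at h1 h2
    exact le_abs_sub_of_even_cells (by positivity) (fun h => hne (Fin.ext h)) h1 h2
  · refine le_max_of_le_right ?_
    have h1 := squarePoint_snd_mem hρ p σ (n + 1)
    have h2 := squarePoint_snd_mem hρ p τ (n + 1)
    simp only [squareCorner, hc] at h1 h2
    exact le_abs_sub_of_even_cells (by positivity)
      (fun h => hne (Fin.succAbove_right_injective (Fin.ext h))) h1 h2

theorem ofReal_log_div_log_le_dimH_twistedBadSet {i j c : ℝ} (hi : 0 ≤ i) (hij : i ≤ j)
    (hj : 0 < j) (hc : 0 < c) {x : ℝ × ℝ}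
    (hx : ∀ q : ℕ, 0 < q → c / (q : ℝ) < weightedDist i j ((q : ℝ) • x)) {K : ℕ} (hK : 1 < K) :
    ENNReal.ofReal (2 * (Real.log K / Real.log (2 * K + 2))) ≤ dimH (twistedBadSet x i j) := by
  have hM1 : (1 : ℝ) < 2 * K + 2 := by linarith [(Nat.cast_nonneg K : (0 : ℝ) ≤ K)]
  have hM0 : (0 : ℝ) < 2 * K + 2 := by linarith
  -- With `T ^ j = M`, the scale of the second coordinate shrinks by `M` per range of `q`, in step
  -- with the squares.
  set T : ℝ := (2 * K + 2 : ℝ) ^ (1 / j) with hT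
  have hT1 : 1 < T := Real.one_lt_rpow hM1 (by positivity)
  have hTM : T ^ j = 2 * K + 2 := by
    rw [hT, ← Real.rpow_mul hM0.le, one_div_mul_cancel hj.ne', Real.rpow_one]
  obtain ⟨δ, ρ, hδ, hρ, hρ4, hδρ, hA, hA'⟩ :=
    exists_small_constants hi hj hc (by linarith : 0 < T) hM0
  choose p hp using exists_bad_row (K := K) hi hij hc hT1.le hTM hδ hρ hρ4 hδρ hA hA' hx
  -- Digit `n` acts in generation `n + 1`; `κ` absorbs the extra factor `2 * K + 2`.
  refine le_dimH_of_digit_separation hK hM1 (κ := ρ / (2 * K + 2)) (by positivity)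
    (squarePoint ρ p) (fun σ => ?_) (fun σ τ n h hne => ?_)
  · refine mem_twistedBadSet hi hj.le hδ ?_ fun q hq hnear => ?_
    · have h1 := squarePoint_fst_mem hρ.le p σ 0
      have h2 := squarePoint_snd_mem hρ.le p σ 0
      simp only [squareCorner, Prod.fst_zero, Prod.snd_zero, pow_zero, div_one, zero_add] at h1 h2
      exact ⟨⟨h1.1, by linarith [h1.2]⟩, ⟨h2.1, by linarith [h2.2]⟩⟩
    · have hq1 : (1 : ℝ) ≤ |(q : ℝ)| := by exact_mod_cast Int.one_le_abs hq
      obtain ⟨m, hm1, hm2⟩ := exists_nat_pow_near hq1 hT1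
      have h := squarePoint_snd_mem hρ.le p σ (m + 1)
      -- A near multiple would force the row of the point to be the avoided one, which `succAbove`
      -- skips.
      refine Fin.succAbove_ne _ _ (hp m (squareCorner ρ p σ m) q (squarePoint ρ p σ)
        ((p m (squareCorner ρ p σ m)).succAbove (σ.2 m)) hm1 hm2 (squarePoint_fst_mem hρ.le p σ m)
        (squarePoint_snd_mem hρ.le p σ m) ?_ hnear)
      simp only [squareCorner] at h
      rw [mul_add_one, ← add_assoc]
      exact h
  · refine le_trans (le_of_eq ?_) (le_dist_squarePoint hρ.le p h hne)
    rw [pow_succ]; field_simp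

theorem dimH_twistedBadSet_of_le {i j c : ℝ} (hi : 0 ≤ i) (hij : i ≤ j) (hj : 0 < j) (hc : 0 < c)
    {x : ℝ × ℝ} (hx : ∀ q : ℕ, 0 < q → c / (q : ℝ) < weightedDist i j ((q : ℝ) • x)) :
    dimH (twistedBadSet x i j) = 2 := by
  refine le_antisymm ?_ ?_
  · refine (dimH_mono (Set.subset_univ _)).trans_eq ?_
    rw [Real.dimH_univ_eq_finrank]
    simp
  · have h := ENNReal.tendsto_ofReal tendsto_log_div_log_two_mul_add
    rw [ENNReal.ofReal_ofNat] at h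
    refine le_of_tendsto h ?_
    filter_upwards [Filter.eventually_gt_atTop 1] with K hK
    exact ofReal_log_div_log_le_dimH_twistedBadSet hi hij hj hc hx hK

/-! ### Symmetry and boundary weights -/

theorem weightedDist_swap (i j : ℝ) (y : ℝ × ℝ) :
    weightedDist j i y.swap = weightedDist i j y := max_comm _ _

theorem twistedBadSet_swap (x : ℝ × ℝ) (i j : ℝ) :
    Prod.swap '' twistedBadSet x i j ⊆ twistedBadSet x.swap j i := by
  rintro _ ⟨γ, ⟨hγ, c, hc, h⟩, rfl⟩
  refine ⟨⟨hγ.2, hγ.1⟩, c, hc, fun q hq => ?_⟩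
  rw [← weightedDist_swap]
  exact h q hq

theorem dimH_twistedBadSet_swap_le (x : ℝ × ℝ) (i j : ℝ) :
    dimH (twistedBadSet x i j) ≤ dimH (twistedBadSet x.swap j i) := by
  have hiso : Isometry (Prod.swap : ℝ × ℝ → ℝ × ℝ) :=
    Isometry.of_dist_eq fun a b => by simp [Prod.dist_eq, max_comm]
  rw [← hiso.dimH_image]
  exact dimH_mono (twistedBadSet_swap x i j)

/-- In the boundary cases the nonzero weight is `1`, so its power is the identity and the
one-dimensional condition bounds the maximum from below. -/
theorem exists_lt_weightedDist_of_mem_badSet {i j : ℝ} (hij : i + j = 1) {x : ℝ × ℝ}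
    (hx : x ∈ badSet i j) :
    ∃ c : ℝ, 0 < c ∧ ∀ q : ℕ, 0 < q → c / (q : ℝ) < weightedDist i j ((q : ℝ) • x) := by
  have hone : ∀ t, weightPow 1 t = t := fun t => by simp [weightPow]
  unfold badSet at hx
  split_ifs at hx with hi hj
  · obtain ⟨-, -, -, c, hc, h⟩ := hx
    obtain rfl : j = 1 := by linarith
    refine ⟨c, hc, fun q hq => lt_max_of_lt_right ?_⟩
    rw [hone]
    exact h q hq
  · obtain ⟨⟨-, -, c, hc, h⟩, -⟩ := hx
    obtain rfl : i = 1 := by linarith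
    refine ⟨c, hc, fun q hq => lt_max_of_lt_left ?_⟩
    rw [hone]
    exact h q hq
  · exact hx.2.2

/-- The metric on `ℝ × ℝ` is bi-Lipschitz equivalent to the Euclidean one, so `dimH` is the usual
Hausdorff dimension of a subset of the plane. -/
theorem mainTheorem2 (i j : ℝ) (hi : 0 ≤ i) (hj : 0 ≤ j) (hij : i + j = 1)
    (x : ℝ × ℝ) (hx : x ∈ badSet i j) :
    dimH (twistedBadSet x i j) = 2 := by
  obtain ⟨c, hc, h⟩ := exists_lt_weightedDist_of_mem_badSet hij hx
  rcases le_total i j with hle | hle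
  · exact dimH_twistedBadSet_of_le hi hle (by linarith) hc h
  · have hswap : dimH (twistedBadSet x.swap j i) = 2 :=
      dimH_twistedBadSet_of_le hj hle (by linarith) hc fun q hq => by
        have := h q hq
        rwa [← weightedDist_swap] at this
    exact ((dimH_twistedBadSet_swap_le x i j).trans_eq hswap).antisymm
      (hswap.symm.trans_le (dimH_twistedBadSet_swap_le x.swap j i))
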